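/- Let $N\in\mathbb N$, let $J$ be a real $2N\times 2N$ matrix with $J^{T}=J^{-1}=-J$, and let $M:\mathbb R\to\mathbb R^{2N\times 2N}$ be continuous with $M(t)$ symmetric for every $t$ and $M(t+T)=M(t)$ for all $t$, for some $T>0$. Let $X$ be the fundamental matrix of the linear system $Jx'-M(t)x=0$ with $X(0)=I$; the characteristic multipliers of the system are the complex eigenvalues of $X(T)$. Suppose that no characteristic multiplier lies on the unit circle $\{\rho\in\mathbb C:|\rho|=1\}$. Let $L^2=L^2(\mathbb R,\mathbb R^{2N})$ and let $H^1=H^1(\mathbb R,\mathbb R^{2N})$ be the Sobolev space of all $u\in L^2$ whose weak derivative $u'$ is in $L^2$, with norm $(\|u\|_{2}^2+\|u'\|_{2}^2)^{1/2}$. Then $$(Lu)(t)=Ju'(t)-M(t)u(t)\quad\text{for a.e. }t\in\mathbb R,\ u\in H^1,$$ defines a bounded linear operator $L:H^1\to L^2$ which is an isomorphism, that is, a bijection with bounded inverse. -/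

import Mathlib

open MeasureTheory
open scoped ContDiff Matrix

namespace PeriodicHamiltonian

/-- `ℝ^{2N}` with the Euclidean norm. -/
abbrev E (N : ℕ) : Type := EuclideanSpace ℝ (Fin (2 * N))

/-- Real `2N × 2N` matrices. -/
abbrev Mat (N : ℕ) : Type := Matrix (Fin (2 * N)) (Fin (2 * N)) ℝ

/-- `L² = L²(ℝ, ℝ^{2N})` (Lebesgue measure, classes of functions modulo equality a.e.). -/
abbrev L2 (N : ℕ) : Type := Lp (E N) 2 (volume : Measure ℝ)

/-- `v` is the weak (distributional) derivative of `u`: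
`∫ φ' u = - ∫ φ v` for every test function `φ ∈ C_c^∞(ℝ)`.
Both integrands are integrable, since `u, v ∈ L²`. -/
def IsWeakDeriv {N : ℕ} (u v : L2 N) : Prop :=
  ∀ φ : ℝ → ℝ, ContDiff ℝ ∞ φ → HasCompactSupport φ →
    ∫ t, deriv φ t • u t = - ∫ t, φ t • v t

lemma integrable_smul {N : ℕ} (u : L2 N) {φ : ℝ → ℝ} (hφ : Continuous φ)
    (hc : HasCompactSupport φ) : Integrable (fun t => φ t • u t) := by
  exact ((Lp.memLp u).locallyIntegrable (by norm_num)).integrable_smul_left_of_hasCompactSupport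
    hφ hc

/-- The weak derivative is unique. -/
lemma IsWeakDeriv.unique {N : ℕ} {u v w : L2 N} (hv : IsWeakDeriv u v) (hw : IsWeakDeriv u w) :
    v = w := by
  have hli : ∀ z : L2 N, LocallyIntegrable (fun t => z t) (volume : Measure ℝ) := fun z =>
    (Lp.memLp z).locallyIntegrable (by norm_num)
  refine Lp.ext (ae_eq_of_integral_contDiff_smul_eq (hli v) (hli w) ?_)
  intro φ hφ hc
  have h := (hv φ hφ hc).symm.trans (hw φ hφ hc)
  exact neg_injective h

/-- The Sobolev space `H¹ = H¹(ℝ, ℝ^{2N})`. An element is an `L²` function `u` together with its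
weak derivative `u' ∈ L²` (which is unique, see `IsWeakDeriv.unique`).  The norm is the one
inherited from the Hilbert sum `L² × L²`, that is `(‖u‖₂² + ‖u'‖₂²)^{1/2}`. -/
def H1 (N : ℕ) : Submodule ℝ (WithLp 2 (L2 N × L2 N)) where
  carrier := {p | IsWeakDeriv p.fst p.snd}
  zero_mem' := by
    intro φ _ _
    have h0 : ((0 : L2 N) : ℝ → E N) =ᵐ[volume] 0 := Lp.coeFn_zero _ _ _
    have h1 : ∀ ψ : ℝ → ℝ, ∫ t, ψ t • ((0 : L2 N) : ℝ → E N) t = 0 := by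
      intro ψ
      refine integral_eq_zero_of_ae ?_
      filter_upwards [h0] with t ht
      simp only [ht, Pi.zero_apply, smul_zero]
    simp only [WithLp.zero_fst, WithLp.zero_snd, h1, neg_zero]
  add_mem' := by
    intro p q hp hq φ hφ hc
    have key : ∀ (x y : L2 N) (ψ : ℝ → ℝ), Continuous ψ → HasCompactSupport ψ →
        ∫ t, ψ t • ((x + y : L2 N) : ℝ → E N) t = (∫ t, ψ t • x t) + ∫ t, ψ t • y t := by
      intro x y ψ h1 h2
      rw [← integral_add (integrable_smul x h1 h2) (integrable_smul y h1 h2)]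
      refine integral_congr_ae ?_
      filter_upwards [Lp.coeFn_add x y] with t ht
      rw [ht, Pi.add_apply, smul_add]
    have hd : Continuous (deriv φ) := hφ.continuous_deriv (by simp)
    rw [WithLp.add_fst, WithLp.add_snd, key _ _ _ hd hc.deriv, key _ _ _ hφ.continuous hc,
      hp φ hφ hc, hq φ hφ hc, neg_add]
  smul_mem' := by
    intro c p hp φ hφ hc
    have key : ∀ (x : L2 N) (ψ : ℝ → ℝ),
        ∫ t, ψ t • ((c • x : L2 N) : ℝ → E N) t = c • ∫ t, ψ t • x t := by
      intro x ψ
      rw [← integral_smul]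
      refine integral_congr_ae ?_
      filter_upwards [Lp.coeFn_smul c x] with t ht
      rw [ht, Pi.smul_apply, smul_comm c (ψ t)]
    rw [WithLp.smul_fst, WithLp.smul_snd, key, key, hp φ hφ hc, smul_neg]

/-- The function underlying an element of `H¹`. -/
def H1.val {N : ℕ} (u : H1 N) : L2 N := (u : WithLp 2 (L2 N × L2 N)).fst

/-- The weak derivative `u'` of `u ∈ H¹`. -/
def H1.weakDeriv {N : ℕ} (u : H1 N) : L2 N := (u : WithLp 2 (L2 N × L2 N)).snd

/-- The norm of `H¹` is `(‖u‖₂² + ‖u'‖₂²)^{1/2}`. -/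
lemma H1.norm_eq {N : ℕ} (u : H1 N) : ‖u‖ = √(‖H1.val u‖ ^ 2 + ‖H1.weakDeriv u‖ ^ 2) :=
  WithLp.prod_norm_eq_of_L2 _

/-- The action of a matrix on `ℝ^{2N}`. -/
noncomputable def act {N : ℕ} (A : Mat N) (x : E N) : E N := WithLp.toLp 2 (A *ᵥ x.ofLp)

/-- `X` is the fundamental matrix of the linear system `J x' - M(t) x = 0` normalised by
`X(0) = I`. -/
def IsFundamentalMatrix {N : ℕ} (J : Mat N) (M X : ℝ → Mat N) : Prop :=
  X 0 = 1 ∧ ∀ t, ∃ X' : Mat N,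
    (∀ i j, HasDerivAt (fun s => X s i j) (X' i j) t) ∧ J * X' - M t * X t = 0

/-- `ρ ∈ ℂ` is a characteristic (Floquet) multiplier of the `T`-periodic system
`J x' - M(t) x = 0`: it is a complex eigenvalue of the monodromy matrix `X(T)`. -/
def IsCharacteristicMultiplier {N : ℕ} (J : Mat N) (M : ℝ → Mat N) (T : ℝ) (ρ : ℂ) : Prop :=
  ∃ X : ℝ → Mat N, IsFundamentalMatrix J M X ∧
    Module.End.HasEigenvalue (Matrix.toLin' ((X T).map (algebraMap ℝ ℂ))) ρ

end PeriodicHamiltonian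

/-! Everything rests on the a priori bound `‖u‖₂ ≤ C ‖L u‖₂`. Pairing `u` with the fundamental
matrix removes the coefficients: for every matrix solution `Z` one has `(Zᵀ J u)' = Zᵀ (J u' - M
u)`, because `M` is symmetric and `Jᵀ J = 1`. Set `w(t) = X(τ)ᵀ J u(t)`, where `τ` in `[0, T)` is
`t` reduced modulo `T`. Integrating over `[t - T, t]` and using `X(τ + T) = X(τ) X(T)` gives `w(t -
T) - X(T)ᵀ w(t) = -∫ Zᵀ L u`, where `Z` is `X` shifted by whole periods
(`norm_floquetPairing_sub_le`). The right side is a moving average, bounded in `L²` by `‖L u‖₂`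
(`eLpNorm_le_of_le_integral`).

It remains to control `w` by `w(· - T) - P w` with `P = X(T)ᵀ`. In the scalar case `P = ρ`, `|ρ| ≠
1`, this is the triangle inequality, since translation is an isometry of `L²`. In general
Cayley-Hamilton makes a product of factors `P - ρ` vanish, and the scalar estimate is applied to one
factor at a time (`exists_eLpNorm_le_of_no_unit_eigenvalue`). No splitting into stable and unstable
subspaces is needed. Since `X` is symplectic, `u` is recovered from `w` with uniform bounds
(`exists_eLpNorm_le`).

The equation then bounds `u'`, so `L` is injective with closed range. A function orthogonal to the
range is a weak solution of `J v' = M v`; it therefore lies in `H¹` and in the kernel of `L`, so it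
is zero (`range_hamiltonianOp_eq_top`). -/

section LinearODE

/-! ### Global solutions of linear differential equations by Picard series. -/

variable {F : Type*} [NormedAddCommGroup F] [NormedSpace ℝ F]

/-- The terms of the Picard (Neumann) series solving `x' = A(t) x`, `x(0) = x₀`. -/
noncomputable def picardTerm (A : ℝ → F →L[ℝ] F) (x₀ : F) : ℕ → ℝ → F
  | 0 => fun _ => x₀
  | k + 1 => fun t => ∫ s in (0 : ℝ)..t, A s (picardTerm A x₀ k s)

lemma continuous_picardTerm {A : ℝ → F →L[ℝ] F} (hA : Continuous A) (x₀ : F) (k : ℕ) :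
    Continuous (picardTerm A x₀ k) := by
  induction k with
  | zero => exact continuous_const
  | succ k ih =>
    exact intervalIntegral.continuous_primitive
      (fun a b => (hA.clm_apply ih).intervalIntegrable a b) 0

lemma hasDerivAt_picardTerm_succ [CompleteSpace F] {A : ℝ → F →L[ℝ] F} (hA : Continuous A) (x₀ : F) (k : ℕ)
    (t : ℝ) : HasDerivAt (picardTerm A x₀ (k + 1)) (A t (picardTerm A x₀ k t)) t := by
  have hc := hA.clm_apply (continuous_picardTerm hA x₀ k)
  exact intervalIntegral.integral_hasDerivAt_right (hc.intervalIntegrable _ _)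
    (hc.stronglyMeasurableAtFilter _ _) hc.continuousAt

/-- Each integration of `|s| ^ k` contributes a factor `1 / (k + 1)`, whence the factorial; the
series is dominated by an exponential series. -/
lemma norm_picardTerm_le {A : ℝ → F →L[ℝ] F} {K : ℝ}
    (hAK : ∀ t, ‖A t‖ ≤ K) (x₀ : F) (k : ℕ) (t : ℝ) :
    ‖picardTerm A x₀ k t‖ ≤ (K * |t|) ^ k / k.factorial * ‖x₀‖ := by
  induction k generalizing t with
  | zero => simp [picardTerm]
  | succ k ih =>
    have h1 : ‖picardTerm A x₀ (k + 1) t‖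
        ≤ ∫ s in Set.uIoc 0 t, K ^ (k + 1) / k.factorial * ‖x₀‖ * |s - 0| ^ k := by
      refine intervalIntegral.norm_integral_le_integral_norm_uIoc.trans ?_
      refine integral_mono_of_nonneg (Filter.Eventually.of_forall fun _ => norm_nonneg _) ?_ ?_
      · refine (Continuous.integrableOn_uIoc ?_)
        fun_prop
      · refine Filter.Eventually.of_forall fun s => ?_
        calc ‖A s (picardTerm A x₀ k s)‖ ≤ K * ((K * |s|) ^ k / k.factorial * ‖x₀‖) :=
              (A s).le_of_opNorm_le_of_le (hAK s) (ih s)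
          _ = _ := by simp only [sub_zero]; ring
    refine h1.trans_eq ?_
    rw [integral_const_mul, integral_pow_abs_sub_uIoc, Nat.factorial_succ]
    push_cast
    rw [sub_zero, mul_pow]
    field_simp

/-- A linear differential equation with bounded continuous coefficients has a global solution. -/
lemma exists_linear_ode_solution [CompleteSpace F] {A : ℝ → F →L[ℝ] F} (hA : Continuous A) {K : ℝ}
    (hAK : ∀ t, ‖A t‖ ≤ K) (x₀ : F) :
    ∃ x : ℝ → F, x 0 = x₀ ∧ ∀ t, HasDerivAt x (A t (x t)) t := by
  have hK : 0 ≤ K := (norm_nonneg _).trans (hAK 0)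
  have hsum : ∀ t, Summable fun k => picardTerm A x₀ k t := fun t =>
    Summable.of_norm_bounded ((Real.summable_pow_div_factorial (K * |t|)).mul_right ‖x₀‖)
      fun k => norm_picardTerm_le hAK x₀ k t
  refine ⟨fun t => ∑' k, picardTerm A x₀ k t, ?_, fun t => ?_⟩
  · refine (tsum_eq_single 0 fun k hk => ?_).trans rfl
    obtain ⟨m, rfl⟩ := Nat.exists_eq_succ_of_ne_zero hk
    simp [picardTerm]
  · have hsplit : (fun t => ∑' k, picardTerm A x₀ k t)
        = fun t => x₀ + ∑' k, picardTerm A x₀ (k + 1) t := by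
      funext s
      exact (hsum s).tsum_eq_zero_add
    rw [(A t).map_tsum (hsum t), hsplit]
    refine HasDerivAt.const_add _ ?_
    -- The domination is uniform only on bounded sets, so the series is differentiated termwise on a
    -- ball around `0` that contains `t`.
    have hR : (0 : ℝ) < |t| + 1 := by positivity
    have hbound : ∀ k, ∀ y ∈ Metric.ball (0 : ℝ) (|t| + 1), ‖A y (picardTerm A x₀ k y)‖
        ≤ K * ((K * (|t| + 1)) ^ k / k.factorial * ‖x₀‖) := by
      intro k y hy
      refine (A y).le_of_opNorm_le_of_le (hAK y) ((norm_picardTerm_le hAK x₀ k y).trans ?_)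
      have : |y| ≤ |t| + 1 := by
        have := Metric.mem_ball.1 hy
        rw [Real.dist_eq, sub_zero] at this
        exact this.le
      gcongr
    have hsum0 : Summable fun k => picardTerm A x₀ (k + 1) 0 :=
      (summable_nat_add_iff (f := fun k => picardTerm A x₀ k 0) 1).2 (hsum 0)
    have ht : t ∈ Metric.ball (0 : ℝ) (|t| + 1) := by simp
    exact hasDerivAt_tsum_of_isPreconnected
      (((Real.summable_pow_div_factorial (K * (|t| + 1))).mul_right ‖x₀‖).mul_left K)
      Metric.isOpen_ball (convex_ball _ _).isPreconnected
      (fun k y _ => hasDerivAt_picardTerm_succ hA x₀ k y) hbound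
      (Metric.mem_ball_self hR) hsum0 ht

end LinearODE

/-! ### Almost everywhere calculus -/

/-- `u` is absolutely continuous on every compact interval, with a.e. derivative `v`. -/
structure HasACDeriv (u v : ℝ → ℝ) : Prop where
  ac : ∀ a b, AbsolutelyContinuousOnInterval u a b
  ae_hasDerivAt : ∀ᵐ t, HasDerivAt u (v t) t

namespace HasACDeriv

variable {u v u' v' : ℝ → ℝ}

lemma continuous (h : HasACDeriv u v) : Continuous u := by
  rw [continuous_iff_continuousAt]
  intro t
  refine ((h.ac (t - 1) (t + 1)).continuousOn).continuousAt ?_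
  rw [Set.uIcc_of_le (by linarith)]
  exact Icc_mem_nhds (by linarith) (by linarith)

lemma add (h : HasACDeriv u v) (h' : HasACDeriv u' v') :
    HasACDeriv (fun t => u t + u' t) (fun t => v t + v' t) where
  ac a b := (h.ac a b).fun_add (h'.ac a b)
  ae_hasDerivAt := by
    filter_upwards [h.ae_hasDerivAt, h'.ae_hasDerivAt] with t h1 h2 using h1.add h2

lemma mul (h : HasACDeriv u v) (h' : HasACDeriv u' v') :
    HasACDeriv (fun t => u t * u' t) (fun t => v t * u' t + u t * v' t) where
  ac a b := (h.ac a b).fun_mul (h'.ac a b)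
  ae_hasDerivAt := by
    filter_upwards [h.ae_hasDerivAt, h'.ae_hasDerivAt] with t h1 h2 using h1.mul h2

lemma of_continuous_deriv (hv : Continuous v) (h : ∀ t, HasDerivAt u (v t) t) :
    HasACDeriv u v where
  ac a b := by
    have : ContDiff ℝ 1 u := contDiff_one_iff_deriv.2
      ⟨fun t => (h t).differentiableAt, by rwa [show deriv u = v from funext fun t => (h t).deriv]⟩
    exact this.contDiffOn.absolutelyContinuousOnInterval
  ae_hasDerivAt := Filter.Eventually.of_forall h

lemma const (c : ℝ) : HasACDeriv (fun _ => c) (fun _ => 0) :=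
  of_continuous_deriv continuous_const fun t => hasDerivAt_const t c

lemma congr_deriv (h : HasACDeriv u v) (hv : ∀ᵐ t, v t = v' t) : HasACDeriv u v' :=
  ⟨h.ac, by filter_upwards [h.ae_hasDerivAt, hv] with t h1 h2 using h2 ▸ h1⟩

lemma sum {ι : Type*} (s : Finset ι) {u v : ι → ℝ → ℝ} (h : ∀ i, HasACDeriv (u i) (v i)) :
    HasACDeriv (fun t => ∑ i ∈ s, u i t) (fun t => ∑ i ∈ s, v i t) := by
  classical
  induction s using Finset.induction_on with
  | empty => simpa using const 0
  | insert i s hi ih => simpa only [Finset.sum_insert hi] using (h i).add ih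

lemma const_add_integral (c : ℝ) (hv : LocallyIntegrable v) :
    HasACDeriv (fun t => c + ∫ s in (0 : ℝ)..t, v s) v where
  ac a b := by
    refine ((const c).ac a b).fun_add ?_
    -- The interval is enlarged to contain `0`, the base point of the primitive.
    have : IntervalIntegrable v volume (min 0 (min a b)) (max 0 (max a b)) :=
      (hv.integrableOn_isCompact isCompact_uIcc).intervalIntegrable
    refine (this.absolutelyContinuousOnInterval_intervalIntegral (c := 0) ?_).mono ?_
    · rw [Set.uIcc_of_le (by simp)]
      simp
    · rw [Set.uIcc_of_le (a := min 0 _) (by simp)]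
      exact Set.Icc_subset_Icc (min_le_right _ _) (le_max_right _ _)
  ae_hasDerivAt := by
    filter_upwards [LocallyIntegrable.ae_hasDerivAt_integral hv] with t ht
    exact (ht 0).const_add c

/-- The fundamental theorem of calculus. -/
lemma integral_eq_sub (h : HasACDeriv u v) (a b : ℝ) : ∫ t in a..b, v t = u b - u a := by
  rw [← (h.ac a b).integral_deriv_eq_sub]
  refine intervalIntegral.integral_congr_ae ?_
  filter_upwards [h.ae_hasDerivAt] with t ht _ using ht.deriv.symm

lemma eq_of_deriv_ae_eq_zero (h : HasACDeriv u v) (hv : ∀ᵐ t, v t = 0) (a b : ℝ) : u a = u b := by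
  have h1 := (h.congr_deriv (v' := fun _ => 0) hv).integral_eq_sub a b
  simp only [intervalIntegral.integral_zero] at h1
  linarith

/-- Integration by parts against a compactly supported function. -/
lemma integral_deriv_mul_eq_neg (h : HasACDeriv u v) {φ : ℝ → ℝ} (hφ : ContDiff ℝ 1 φ)
    (hc : HasCompactSupport φ) : ∫ t, deriv φ t * u t = - ∫ t, φ t * v t := by
  obtain ⟨R, hR⟩ := hc.isCompact.isBounded.subset_ball 0
  have hφ0 : ∀ t, R ≤ |t| → φ t = 0 := fun t ht => image_eq_zero_of_notMem_tsupport fun hm => by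
    have := Metric.mem_ball.1 (hR hm)
    rw [Real.dist_eq, sub_zero] at this
    linarith
  have hφ' : ∀ t, R ≤ |t| → deriv φ t = 0 := fun t ht =>
    image_eq_zero_of_notMem_tsupport fun hm => by
      have := Metric.mem_ball.1 (hR (tsupport_deriv_subset hm))
      rw [Real.dist_eq, sub_zero] at this
      linarith
  have hprod := (of_continuous_deriv (hφ.continuous_deriv le_rfl)
    (fun t => (hφ.differentiable one_ne_zero t).hasDerivAt)).mul h
  -- `R` may be negative when the support is empty, hence `|R|`. Since `φ` vanishes at both
  -- endpoints, there will be no boundary terms.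
  have key : ∀ g : ℝ → ℝ, (∀ t, R ≤ |t| → g t = 0) → ∫ t, g t = ∫ t in -(|R|+1)..(|R|+1), g t := by
    intro g hg
    refine (intervalIntegral.integral_eq_integral_of_support_subset fun t ht => ?_).symm
    by_contra hcon
    refine ht (hg t ?_)
    by_contra hlt
    push Not at hlt
    have h1 := (abs_lt.1 hlt).1
    have h2 := (abs_lt.1 hlt).2
    have h3 := le_abs_self R
    exact hcon ⟨by linarith, by linarith⟩
  have hvloc : IntervalIntegrable v volume (-(|R|+1)) (|R|+1) := by
    refine ((h.ac _ _).intervalIntegrable_deriv).congr_ae ?_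
    refine ae_restrict_of_ae ?_
    filter_upwards [h.ae_hasDerivAt] with t ht using ht.deriv
  rw [key _ fun t ht => by rw [hφ' t ht, zero_mul], key _ fun t ht => by rw [hφ0 t ht, zero_mul],
    eq_neg_iff_add_eq_zero, ← intervalIntegral.integral_add, hprod.integral_eq_sub]
  · have h1 : R ≤ |(|R|+1)| := by rw [abs_of_pos (by positivity)]; linarith [le_abs_self R]
    rw [hφ0 _ h1, hφ0 _ (by rwa [abs_neg])]
    simp
  · exact ((hφ.continuous_deriv le_rfl).mul h.continuous).intervalIntegrable _ _
  · exact hvloc.continuousOn_mul hφ.continuous.continuousOn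

end HasACDeriv

/-! ### The du Bois-Reymond lemma -/

/-- A smooth compactly supported function of integral zero is the derivative of a smooth compactly
supported function. -/
lemma exists_deriv_eq_of_integral_eq_zero {θ : ℝ → ℝ} (hθ : ContDiff ℝ ∞ θ)
    (hc : HasCompactSupport θ) (h0 : ∫ t, θ t = 0) :
    ∃ φ : ℝ → ℝ, ContDiff ℝ ∞ φ ∧ HasCompactSupport φ ∧ deriv φ = θ := by
  obtain ⟨R, hR⟩ := hc.isCompact.isBounded.subset_ball 0
  have hout : ∀ t, R ≤ |t| → θ t = 0 := fun t ht => image_eq_zero_of_notMem_tsupport fun hm => by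
    have := Metric.mem_ball.1 (hR hm)
    rw [Real.dist_eq, sub_zero] at this
    linarith
  have hle := le_abs_self R
  have hpos := abs_nonneg R
  have hd : ∀ t, HasDerivAt (fun t => ∫ s in (-|R|)..t, θ s) (θ t) t := fun t =>
    intervalIntegral.integral_hasDerivAt_right (hθ.continuous.intervalIntegrable _ _)
      (hθ.continuous.stronglyMeasurableAtFilter _ _) hθ.continuous.continuousAt
  have hderiv : deriv (fun t => ∫ s in (-|R|)..t, θ s) = θ := funext fun t => (hd t).deriv
  refine ⟨fun t => ∫ s in (-|R|)..t, θ s, ?_, ?_, hderiv⟩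
  · exact contDiff_infty_iff_deriv.2 ⟨fun t => (hd t).differentiableAt, hderiv.symm ▸ hθ⟩
  · refine HasCompactSupport.intro (isCompact_Icc (a := -|R|) (b := |R|)) fun t ht => ?_
    rw [Set.mem_Icc, not_and_or, not_le, not_le] at ht
    rcases ht with ht | ht
    · refine intervalIntegral.integral_zero_ae (Filter.Eventually.of_forall fun s hs => hout s ?_)
      rw [Set.uIoc_of_ge ht.le] at hs
      have : s ≤ -|R| := hs.2
      rw [abs_of_nonpos (by linarith)]
      linarith
    -- To the right of the support the primitive equals the full integral; only here is the
    -- vanishing of that integral needed.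
    · refine (intervalIntegral.integral_eq_integral_of_support_subset fun s hs => ?_).trans h0
      by_contra hcon
      refine hs (hout s ?_)
      rw [Set.mem_Ioc, not_and_or, not_lt, not_le] at hcon
      rcases hcon with h | h
      · rw [abs_of_nonpos (by linarith)]; linarith
      · exact hle.trans ((ht.trans h).le.trans (le_abs_self s))

/-- A locally integrable function with vanishing weak derivative is constant. -/
lemma ae_eq_const_of_integral_deriv_mul_eq_zero {w : ℝ → ℝ} (hw : LocallyIntegrable w)
    (h : ∀ φ : ℝ → ℝ, ContDiff ℝ ∞ φ → HasCompactSupport φ → ∫ t, deriv φ t * w t = 0) :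
    ∃ c : ℝ, ∀ᵐ t, w t = c := by
  let b : ContDiffBump (0 : ℝ) := ⟨1, 2, one_pos, one_lt_two⟩
  let η : ℝ → ℝ := b.normed volume
  have hη : ContDiff ℝ ∞ η := b.contDiff_normed
  have hηc : HasCompactSupport η := b.hasCompactSupport_normed
  have hη1 : ∫ t, η t = 1 := b.integral_normed
  have hint : ∀ ψ : ℝ → ℝ, Continuous ψ → HasCompactSupport ψ →
      Integrable fun t => ψ t * w t := fun ψ h1 h2 =>
    hw.integrable_smul_left_of_hasCompactSupport h1 h2
  refine ⟨∫ t, η t * w t, ?_⟩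
  refine ae_eq_of_integral_contDiff_smul_eq (f' := fun _ => ∫ t, η t * w t) hw
    (locallyIntegrable_const _) fun ψ hψ hψc => ?_
  -- Subtracting `(∫ ψ) η` makes the integral zero, so the difference is an admissible `φ'`. Testing
  -- `w` against it gives `∫ ψ w = (∫ ψ) (∫ η w)`, which identifies the constant.
  obtain ⟨φ, hφ, hφc, hd⟩ := exists_deriv_eq_of_integral_eq_zero
    (θ := fun t => ψ t - (∫ s, ψ s) * η t) (hψ.sub (contDiff_const.mul hη))
    (hψc.sub hηc.mul_left) (by
      rw [integral_sub (hψ.continuous.integrable_of_hasCompactSupport hψc)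
        ((hη.continuous.integrable_of_hasCompactSupport hηc).const_mul _), integral_const_mul,
        hη1, mul_one, sub_self])
  have h1 := h φ hφ hφc
  have h2 : (fun t => deriv φ t * w t)
      = fun t => ψ t * w t - (∫ s, ψ s) * (η t * w t) := by
    rw [hd]; funext t; ring
  rw [h2, integral_sub (hint ψ hψ.continuous hψc) ((hint η hη.continuous hηc).const_mul _),
    integral_const_mul, sub_eq_zero] at h1
  simp only [smul_eq_mul]
  rw [h1, integral_mul_const]

/-- A locally integrable function with locally integrable weak derivative has an absolutely
continuous representative. -/
lemma exists_hasACDeriv_of_weak_deriv {u v : ℝ → ℝ} (hu : LocallyIntegrable u)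
    (hv : LocallyIntegrable v)
    (h : ∀ φ : ℝ → ℝ, ContDiff ℝ ∞ φ → HasCompactSupport φ →
      ∫ t, deriv φ t * u t = - ∫ t, φ t * v t) :
    ∃ U : ℝ → ℝ, HasACDeriv U v ∧ u =ᵐ[volume] U := by
  have hF := HasACDeriv.const_add_integral 0 hv
  -- `u` minus a primitive of `v` has zero weak derivative.
  obtain ⟨c, hc⟩ := ae_eq_const_of_integral_deriv_mul_eq_zero
    (hu.sub hF.continuous.locallyIntegrable) fun φ hφ hφc => by
      have hφ1 : ContDiff ℝ 1 φ := hφ.of_le (by simp)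
      have hd := hφ1.continuous_deriv le_rfl
      simp only [Pi.sub_apply, mul_sub]
      rw [integral_sub, h φ hφ hφc, hF.integral_deriv_mul_eq_neg hφ1 hφc, sub_self]
      · exact hu.integrable_smul_left_of_hasCompactSupport hd hφc.deriv
      · exact hF.continuous.locallyIntegrable.integrable_smul_left_of_hasCompactSupport hd
          hφc.deriv
  refine ⟨_, HasACDeriv.const_add_integral c hv, ?_⟩
  filter_upwards [hc] with t ht
  simp only [Pi.sub_apply, zero_add] at ht
  linarith

/-! ### Absolutely continuous representatives of Sobolev functions. -/

namespace PeriodicHamiltonian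

variable {N : ℕ}

/-- Every `u ∈ H¹` has an absolutely continuous representative. -/
lemma IsWeakDeriv.exists_hasACDeriv {u v : L2 N} (h : IsWeakDeriv u v) :
    ∃ U : ℝ → E N, (∀ i, HasACDeriv (fun t => U t i) (fun t => v t i)) ∧ u =ᵐ[volume] U := by
  have hloc : ∀ (x : L2 N) (i : Fin (2 * N)), LocallyIntegrable fun t => x t i := fun x i =>
    ((Lp.memLp x).locallyIntegrable (by norm_num)).mono
      ((EuclideanSpace.proj (𝕜 := ℝ) i).continuous.comp_aestronglyMeasurable
        (Lp.aestronglyMeasurable x))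
      (Filter.Eventually.of_forall fun t => PiLp.norm_apply_le (x t) i)
  have hcoord : ∀ (x : L2 N) (i : Fin (2 * N)) (ψ : ℝ → ℝ), Continuous ψ → HasCompactSupport ψ →
      (∫ t, ψ t • x t) i = ∫ t, ψ t * x t i := fun x i ψ h1 h2 =>
    ((EuclideanSpace.proj (𝕜 := ℝ) i).integral_comp_comm (integrable_smul x h1 h2)).symm
  have hi : ∀ i, ∃ U : ℝ → ℝ, HasACDeriv U (fun t => v t i) ∧ (fun t => u t i) =ᵐ[volume] U :=
    fun i => exists_hasACDeriv_of_weak_deriv (hloc u i) (hloc v i) fun φ hφ hφc => by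
      rw [← hcoord u i _ (hφ.continuous_deriv (by simp)) hφc.deriv,
        ← hcoord v i _ hφ.continuous hφc, h φ hφ hφc]
      rfl
  choose U hU hUe using hi
  refine ⟨fun t => WithLp.toLp 2 fun i => U i t, hU, ?_⟩
  filter_upwards [ae_all_iff.2 hUe] with t ht
  ext i
  exact ht i

end PeriodicHamiltonian

namespace PeriodicHamiltonian

variable {N : ℕ}

/-! ### Matrix solutions -/

/-- `Z` is a matrix solution of `J Z' = M(t) Z`, written as `Z' = -J M(t) Z`. -/
def IsMatrixSolution (J : Mat N) (M Z : ℝ → Mat N) : Prop :=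
  ∀ t i j, HasDerivAt (fun s => Z s i j) ((-(J * M t * Z t)) i j) t

section

variable {J : Mat N} {M Z X : ℝ → Mat N}

lemma mul_self_eq_neg_one (hJskew : Jᵀ = -J) (hJorth : Jᵀ * J = 1) : J * J = -1 := by
  rw [hJskew, neg_mul] at hJorth
  rw [← hJorth, neg_neg]

lemma IsMatrixSolution.continuous (hZ : IsMatrixSolution J M Z) : Continuous Z :=
  continuous_matrix fun i j => continuous_iff_continuousAt.2 fun t => (hZ t i j).continuousAt

lemma IsMatrixSolution.isFundamentalMatrix (hJ : J * J = -1) (hX : IsMatrixSolution J M X)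
    (h0 : X 0 = 1) : IsFundamentalMatrix J M X := by
  refine ⟨h0, fun t => ⟨_, hX t, ?_⟩⟩
  rw [mul_neg, ← mul_assoc, ← mul_assoc, hJ]
  simp

lemma IsMatrixSolution.comp_add_const (hZ : IsMatrixSolution J M Z) {c : ℝ}
    (hc : ∀ t, M (t + c) = M t) : IsMatrixSolution J M fun t => Z (t + c) := fun t i j => by
  have := (hZ (t + c) i j).comp_add_const t c
  rwa [hc] at this

/-- Matrices as bounded operators on `Fin (2 * N) → ℝ` (with the supremum norm). -/
noncomputable def mulVecCLM (N : ℕ) :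
    Mat N →ₗ[ℝ] ((Fin (2 * N) → ℝ) →L[ℝ] (Fin (2 * N) → ℝ)) :=
  LinearMap.toContinuousLinearMap.toLinearMap ∘ₗ Matrix.toLin'.toLinearMap

lemma mulVecCLM_apply (B : Mat N) (x : Fin (2 * N) → ℝ) : mulVecCLM N B x = B *ᵥ x := rfl

/-- Existence of the fundamental matrix. -/
lemma exists_isMatrixSolution (J : Mat N) (hM : Continuous M) {T : ℝ} (hT : 0 < T)
    (hper : Function.Periodic M T) : ∃ X : ℝ → Mat N, X 0 = 1 ∧ IsMatrixSolution J M X := by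
  let A : ℝ → (Fin (2 * N) → ℝ) →L[ℝ] (Fin (2 * N) → ℝ) := fun t => mulVecCLM N (-(J * M t))
  have hA : Continuous A := (mulVecCLM N).continuous_of_finiteDimensional.comp
    (continuous_const.mul hM).neg
  have hAper : Function.Periodic A T := fun t => by simp only [A, hper t]
  -- Periodicity and continuity supply the global bound required by the Picard series.
  obtain ⟨K, hK⟩ := (hAper.isBounded_of_continuous hT.ne' hA).exists_norm_le
  have hAK : ∀ t, ‖A t‖ ≤ K := fun t => hK _ ⟨t, rfl⟩
  choose x hx0 hx using fun j => exists_linear_ode_solution hA hAK (Pi.single j (1 : ℝ))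
  refine ⟨fun t => Matrix.of fun i j => x j t i, ?_, fun t i j => ?_⟩
  · ext i j
    change x j 0 i = _
    rw [hx0, Matrix.one_apply, Pi.single_apply]
  · have := hasDerivAt_pi.1 (hx j t) i
    rw [mulVecCLM_apply] at this
    rw [← neg_mul]
    exact this

end

/-! ### Symplectic pairing of solutions and the monodromy relation. -/

section

variable {J : Mat N} {M Z X : ℝ → Mat N} (hJskew : Jᵀ = -J) (hJorth : Jᵀ * J = 1)
  (hMsymm : ∀ t, (M t).IsSymm)

include hJorth hMsymm

/-- The derivative of the symplectic pairing of a solution with an absolutely continuous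
function. -/
lemma IsMatrixSolution.hasACDeriv_pairing (hM : Continuous M) (hZ : IsMatrixSolution J M Z)
    {U v : ℝ → Fin (2 * N) → ℝ} (hU : ∀ i, HasACDeriv (fun t => U t i) (fun t => v t i))
    (k : Fin (2 * N)) :
    HasACDeriv (fun t => ((Z t)ᵀ *ᵥ (J *ᵥ U t)) k)
      (fun t => ((Z t)ᵀ *ᵥ (J *ᵥ v t - M t *ᵥ U t)) k) := by
  have hZac : ∀ i j, HasACDeriv (fun s => Z s i j) (fun t => (-(J * M t * Z t)) i j) :=
    fun i j => HasACDeriv.of_continuous_deriv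
      (((continuous_const.matrix_mul hM).matrix_mul hZ.continuous).neg.matrix_elem i j)
      fun t => hZ t i j
  have hJU : ∀ i, HasACDeriv (fun t => (J *ᵥ U t) i) (fun t => (J *ᵥ v t) i) := fun i => by
    have := HasACDeriv.sum Finset.univ fun j => (HasACDeriv.const (J i j)).mul (hU j)
    simpa only [zero_mul, zero_add, Matrix.mulVec, dotProduct] using this
  have h := HasACDeriv.sum Finset.univ fun i => (hZac i k).mul (hJU i)
  refine h.congr_deriv (Filter.Eventually.of_forall fun t => ?_)
  -- Symmetry of `M` and `Jᵀ J = 1` enter here: they turn the term with `Z'` into exactly the `M U`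
  -- part of `J v - M U`.
  have e1 : (-(J * M t * Z t))ᵀ *ᵥ (J *ᵥ U t) = -((Z t)ᵀ *ᵥ (M t *ᵥ U t)) := by
    rw [Matrix.mulVec_mulVec, Matrix.transpose_neg, Matrix.transpose_mul, Matrix.transpose_mul,
      (hMsymm t).eq, neg_mul, mul_assoc, mul_assoc, hJorth, mul_one, Matrix.neg_mulVec,
      Matrix.mulVec_mulVec]
  rw [Finset.sum_add_distrib]
  change ((-(J * M t * Z t))ᵀ *ᵥ (J *ᵥ U t)) k + ((Z t)ᵀ *ᵥ (J *ᵥ v t)) k = _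
  rw [e1, Matrix.mulVec_sub, Pi.neg_apply, Pi.sub_apply]
  ring

include hJskew

/-- When `U` is a column of a solution, `J U' - M U = 0`, so the pairing has zero derivative. -/
lemma IsMatrixSolution.transpose_mul_mul_eq (hM : Continuous M) (hZ : IsMatrixSolution J M Z)
    (hX : IsMatrixSolution J M X) (s t : ℝ) : (Z s)ᵀ * J * X s = (Z t)ᵀ * J * X t := by
  have hJ := mul_self_eq_neg_one hJskew hJorth
  ext k j
  have h := hZ.hasACDeriv_pairing hJorth hMsymm hM (U := fun t => (X t).col j)
    (v := fun t => (-(J * M t * X t)).col j)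
    (fun i => HasACDeriv.of_continuous_deriv
      (((continuous_const.matrix_mul hM).matrix_mul hX.continuous).neg.matrix_elem i j)
      fun t => hX t i j) k
  have h0 : ∀ t, J *ᵥ (-(J * M t * X t)).col j - M t *ᵥ (X t).col j = 0 := by
    intro t
    have : J * -(J * M t * X t) = M t * X t := by
      rw [mul_neg, ← mul_assoc, ← mul_assoc, hJ]
      simp
    rw [← Matrix.mulVec_single_one, ← Matrix.mulVec_single_one, Matrix.mulVec_mulVec,
      Matrix.mulVec_mulVec, this, sub_self]
  have h1 := h.eq_of_deriv_ae_eq_zero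
    (Filter.Eventually.of_forall fun t => by rw [h0, Matrix.mulVec_zero]; rfl) s t
  rw [Matrix.mulVec_mulVec, Matrix.mulVec_mulVec] at h1
  exact h1

/-- The fundamental matrix is symplectic. -/
lemma IsMatrixSolution.symplectic (hM : Continuous M) (hX : IsMatrixSolution J M X)
    (h0 : X 0 = 1) (t : ℝ) : (X t)ᵀ * J * X t = J := by
  rw [hX.transpose_mul_mul_eq hJskew hJorth hMsymm hM hX t 0, h0]
  simp

/-- The relation `Xᵀ J X = J` exhibits `-J Xᵀ J` as a left inverse of the square matrix `X`, hence
as a right inverse. -/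
lemma IsMatrixSolution.symplectic' (hM : Continuous M) (hX : IsMatrixSolution J M X)
    (h0 : X 0 = 1) (t : ℝ) : X t * J * (X t)ᵀ = J := by
  have hJ := mul_self_eq_neg_one hJskew hJorth
  have h := hX.symplectic hJskew hJorth hMsymm hM h0 t
  have h1 : (-(J * (X t)ᵀ * J)) * X t = 1 := by
    rw [neg_mul, mul_assoc, mul_assoc, ← mul_assoc (X t)ᵀ, h, hJ, neg_neg]
  have h2 := mul_eq_one_comm.1 h1
  have h3 : X t * J * (X t)ᵀ * J * J = - J := by
    rw [mul_neg, neg_eq_iff_eq_neg] at h2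
    rw [← neg_one_mul, ← h2]
    simp only [mul_assoc]
  rw [mul_assoc _ J J, hJ, mul_neg, mul_one] at h3
  exact neg_injective h3

/-- The shifted matrix is again a solution, so its conserved pairing with `X` gives `X(t)ᵀ J X(t +
T) = J X(T)`. Multiplying by `X(t) J` yields the claim without an appeal to uniqueness of solutions.
-/
lemma IsMatrixSolution.add_period (hM : Continuous M) (hX : IsMatrixSolution J M X)
    (h0 : X 0 = 1) {T : ℝ} (hper : Function.Periodic M T) (t : ℝ) :
    X (t + T) = X t * X T := by
  have hJ := mul_self_eq_neg_one hJskew hJorth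
  have h1 := hX.transpose_mul_mul_eq hJskew hJorth hMsymm hM (hX.comp_add_const hper) t 0
  have h2 := congrArg (fun B => X t * J * B) h1
  simp only [h0, zero_add, Matrix.transpose_one, one_mul] at h2
  rw [← mul_assoc, ← mul_assoc, hX.symplectic' hJskew hJorth hMsymm hM h0, hJ, mul_assoc (X t),
    ← mul_assoc J, hJ] at h2
  simpa using h2

end

end PeriodicHamiltonian

/-! ### An estimate for vector-valued difference equations -/

section DifferenceEquation

open scoped ENNReal

variable {W : Type*} [NormedAddCommGroup W]

lemma memLp_comp_sub_right {w : ℝ → W} (hw : MemLp w 2) (T : ℝ) :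
    MemLp (fun t => w (t - T)) 2 :=
  hw.comp_measurePreserving (measurePreserving_sub_right volume T)

lemma eLpNorm_comp_sub_right {w : ℝ → W} (hw : MemLp w 2) (T : ℝ) :
    eLpNorm (fun t => w (t - T)) 2 = eLpNorm w 2 :=
  eLpNorm_comp_measurePreserving hw.1 (measurePreserving_sub_right volume T)

variable [NormedSpace ℂ W]

/-- The scalar difference equation `w(t - T) = ρ w(t) + g(t)` with `|ρ| ≠ 1`. -/
lemma eLpNorm_le_of_norm_ne_one {ρ : ℂ} (hρ : ‖ρ‖ ≠ 1) (T : ℝ) {w : ℝ → W} (hw : MemLp w 2) :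
    eLpNorm w 2 ≤ ENNReal.ofReal |1 - ‖ρ‖|⁻¹ * eLpNorm (fun t => w (t - T) - ρ • w t) 2 := by
  have hU := memLp_comp_sub_right hw T
  have hg : MemLp (fun t => w (t - T) - ρ • w t) 2 := hU.sub (hw.const_smul ρ)
  have hρw : eLpNorm (fun t => ρ • w t) 2 = ENNReal.ofReal ‖ρ‖ * eLpNorm w 2 := by
    rw [ofReal_norm]
    exact eLpNorm_const_smul ρ w 2 volume
  -- The two triangle inequalities `h1` and `h2` settle `‖ρ‖ < 1` and `‖ρ‖ > 1` respectively.
  have h1 : eLpNorm w 2 ≤ eLpNorm (fun t => w (t - T) - ρ • w t) 2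
      + ENNReal.ofReal ‖ρ‖ * eLpNorm w 2 := by
    rw [← hρw, ← eLpNorm_comp_sub_right hw T]
    refine le_trans (le_of_eq ?_) (eLpNorm_add_le hg.1 (hw.const_smul ρ).1 one_le_two)
    congr 1
    funext t
    simp
  have h2 : ENNReal.ofReal ‖ρ‖ * eLpNorm w 2 ≤ eLpNorm w 2
      + eLpNorm (fun t => w (t - T) - ρ • w t) 2 := by
    rw [← hρw]
    conv_rhs => rw [← eLpNorm_comp_sub_right hw T]
    refine le_trans (le_of_eq ?_) (eLpNorm_sub_le hU.1 hg.1 one_le_two)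
    congr 1
    funext t
    simp
  -- Finiteness of both norms is essential: the term in `‖w‖` has to be moved across the inequality.
  have ha := hw.eLpNorm_ne_top
  have hd := hg.eLpNorm_ne_top
  generalize eLpNorm w 2 = a at *
  generalize eLpNorm (fun t => w (t - T) - ρ • w t) 2 = d at *
  lift a to NNReal using ha
  lift d to NNReal using hd
  have e : ∀ x : ℝ, 0 ≤ x → ENNReal.ofReal x = ((x.toNNReal : NNReal) : ℝ≥0∞) := fun x _ => rfl
  rw [e _ (norm_nonneg _)] at h1 h2
  rw [e _ (by positivity)]
  norm_cast at h1 h2 ⊢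
  rw [← NNReal.coe_le_coe] at h1 h2 ⊢
  push_cast [Real.coe_toNNReal _ (norm_nonneg ρ)] at h1 h2 ⊢
  have hpos : 0 < |1 - ‖ρ‖| := abs_pos.2 (sub_ne_zero.2 hρ.symm)
  rw [Real.coe_toNNReal _ (inv_nonneg.2 hpos.le), inv_mul_eq_div, le_div_iff₀ hpos]
  rcases abs_cases (1 - ‖ρ‖) with ⟨h, _⟩ | ⟨h, _⟩ <;> rw [h] <;> linarith

/-- Iterating the scalar estimate along a product of linear factors annihilating `w`. -/
lemma exists_eLpNorm_le_of_list_prod_eq_zero (P : W →L[ℂ] W) (T : ℝ) (l : List ℂ)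
    (hl : ∀ ρ ∈ l, ‖ρ‖ ≠ 1) :
    ∃ C : ℝ, ∀ w : ℝ → W, MemLp w 2 →
      (∀ t, (l.map fun ρ => (P : W →ₗ[ℂ] W) - algebraMap ℂ _ ρ).prod (w t) = 0) →
      eLpNorm w 2 ≤ ENNReal.ofReal C * eLpNorm (fun t => w (t - T) - P (w t)) 2 := by
  -- The last factor acts first: if the whole product kills `w`, the product over the shorter list
  -- kills `R w` with `R = P - ρ`.
  induction l using List.reverseRecOn with
  | nil =>
    refine ⟨0, fun w _ h0 => ?_⟩
    have : w = 0 := funext fun t => by simpa using h0 t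
    simp [this]
  | append_singleton l ρ ih =>
    obtain ⟨C, hC⟩ := ih fun σ hσ => hl σ (by simp [hσ])
    have hρ : ‖ρ‖ ≠ 1 := hl ρ (by simp)
    let R : W →L[ℂ] W := P - ρ • ContinuousLinearMap.id ℂ W
    have hR : ∀ x, R x = P x - ρ • x := fun x => rfl
    refine ⟨|1 - ‖ρ‖|⁻¹ * (1 + max C 0 * ‖R‖), fun w hw h0 => ?_⟩
    have hPw : MemLp (fun t => P (w t)) 2 := P.comp_memLp' hw
    have hRw : MemLp (fun t => R (w t)) 2 := R.comp_memLp' hw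
    have hd : MemLp (fun t => w (t - T) - P (w t)) 2 := (memLp_comp_sub_right hw T).sub hPw
    have h1 := hC (fun t => R (w t)) hRw fun t => by
      have := h0 t
      rw [List.map_append, List.prod_append] at this
      simpa [hR] using this
    -- `R` commutes with `P`, so the defect of `R w` is `R` applied to the defect of `w`.
    have h2 : eLpNorm (fun t => R (w (t - T)) - P (R (w t))) 2
        ≤ ENNReal.ofReal ‖R‖ * eLpNorm (fun t => w (t - T) - P (w t)) 2 := by
      refine eLpNorm_le_mul_eLpNorm_of_ae_le_mul (Filter.Eventually.of_forall fun t => ?_) 2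
      have : R (w (t - T)) - P (R (w t)) = R (w (t - T) - P (w t)) := by
        simp only [hR, map_sub, map_smul, smul_sub]
        abel
      rw [this]
      exact R.le_opNorm _
    have h3 : eLpNorm (fun t => w (t - T) - ρ • w t) 2
        ≤ eLpNorm (fun t => w (t - T) - P (w t)) 2 + eLpNorm (fun t => R (w t)) 2 := by
      refine le_trans (le_of_eq ?_) (eLpNorm_add_le hd.1 hRw.1 one_le_two)
      congr 1
      funext t
      simp [hR]
    have h4 : ENNReal.ofReal C ≤ ENNReal.ofReal (max C 0) :=
      ENNReal.ofReal_le_ofReal (le_max_left _ _)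
    refine (eLpNorm_le_of_norm_ne_one hρ T hw).trans ?_
    rw [ENNReal.ofReal_mul (by positivity), mul_assoc]
    gcongr
    rw [ENNReal.ofReal_add zero_le_one (by positivity), ENNReal.ofReal_one, add_mul, one_mul,
      ENNReal.ofReal_mul (le_max_right _ _), mul_assoc]
    exact h3.trans (add_le_add_right (h1.trans (mul_le_mul' h4 h2)) _)

/-- If `P` has no eigenvalue on the unit circle, then `w` is controlled in `L²` by
`w(· - T) - P w`. -/
lemma exists_eLpNorm_le_of_no_unit_eigenvalue [FiniteDimensional ℂ W] (P : W →L[ℂ] W) (T : ℝ)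
    (hP : ∀ ρ : ℂ, ‖ρ‖ = 1 → ¬ Module.End.HasEigenvalue (P : W →ₗ[ℂ] W) ρ) :
    ∃ C : ℝ, ∀ w : ℝ → W, MemLp w 2 →
      eLpNorm w 2 ≤ ENNReal.ofReal C * eLpNorm (fun t => w (t - T) - P (w t)) 2 := by
  -- Over `ℂ` the characteristic polynomial splits, its roots are eigenvalues, and it annihilates
  -- `P` by Cayley-Hamilton.
  let p := LinearMap.charpoly (P : W →ₗ[ℂ] W)
  have hmonic : p.Monic := LinearMap.charpoly_monic _
  obtain ⟨C, hC⟩ := exists_eLpNorm_le_of_list_prod_eq_zero P T p.roots.toList fun ρ hρ h1 =>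
    hP ρ h1 ((Module.End.hasEigenvalue_iff_isRoot_charpoly _ _).2
      (Polynomial.isRoot_of_mem_roots (Multiset.mem_toList.1 hρ)))
  refine ⟨C, fun w hw => hC w hw fun t => ?_⟩
  have hfac : (p.roots.toList.map fun a => Polynomial.X - Polynomial.C a).prod = p := by
    rw [← Multiset.prod_coe, ← Multiset.map_coe, Multiset.coe_toList]
    exact (Polynomial.Splits.eq_prod_roots_of_monic (IsAlgClosed.splits p) hmonic).symm
  have hzero : Polynomial.aeval (P : W →ₗ[ℂ] W) p = 0 := LinearMap.aeval_self_charpoly _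
  rw [← hfac, map_list_prod, List.map_map] at hzero
  have : (p.roots.toList.map fun ρ => (P : W →ₗ[ℂ] W) - algebraMap ℂ _ ρ).prod = 0 := by
    rw [← hzero]
    congr 2
    funext ρ
    simp
  rw [this, LinearMap.zero_apply]

end DifferenceEquation

/-! ### Moving averages -/

open scoped ENNReal in
/-- The moving average `t ↦ ∫_{t-T}^t |f|` is bounded on `L²`. -/
lemma eLpNorm_le_of_le_integral {F G : Type*} [NormedAddCommGroup F] [NormedAddCommGroup G]
    {f : ℝ → F} (hf : MemLp f 2) {h : ℝ → G} {K T : ℝ} (hK : 0 ≤ K) (hT : 0 ≤ T)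
    (hh : ∀ t, ‖h t‖ ≤ K * ∫ s in (t - T)..t, ‖f s‖) :
    eLpNorm h 2 ≤ ENNReal.ofReal (K * T) * eLpNorm f 2 := by
  -- Cauchy-Schwarz on a window of length `T` gives one factor `T`; Tonelli will give the second.
  have hpt : ∀ t, ‖h t‖ₑ ^ 2 ≤ ENNReal.ofReal (K ^ 2 * T)
      * ∫⁻ s in Set.Ioc (t - T) t, ‖f s‖ₑ ^ 2 := by
    intro t
    have hint : ENNReal.ofReal (∫ s in (t - T)..t, ‖f s‖) ≤ ∫⁻ s in Set.Ioc (t - T) t, ‖f s‖ₑ := by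
      rw [intervalIntegral.integral_of_le (by linarith),
        integral_norm_eq_lintegral_enorm hf.1.restrict]
      exact ENNReal.ofReal_toReal_le
    have hcs := eLpNorm_le_eLpNorm_mul_rpow_measure_univ (μ := volume.restrict (Set.Ioc (t - T) t))
      (f := f) (p := 1) (q := 2) one_le_two hf.1.restrict
    rw [eLpNorm_one_eq_lintegral_enorm] at hcs
    have hvol : (volume.restrict (Set.Ioc (t - T) t)) Set.univ = ENNReal.ofReal T := by
      simp
    have h2 : (eLpNorm f 2 (volume.restrict (Set.Ioc (t - T) t))) ^ 2
        = ∫⁻ s in Set.Ioc (t - T) t, ‖f s‖ₑ ^ 2 := by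
      have := eLpNorm_nnreal_pow_eq_lintegral (f := f)
        (μ := volume.restrict (Set.Ioc (t - T) t)) (p := 2) two_ne_zero
      simpa using this
    have h3 : ‖h t‖ₑ ≤ ENNReal.ofReal K * (eLpNorm f 2 (volume.restrict (Set.Ioc (t - T) t))
        * ENNReal.ofReal T ^ (1 / 2 : ℝ)) := by
      calc ‖h t‖ₑ = ENNReal.ofReal ‖h t‖ := (ofReal_norm _).symm
        _ ≤ ENNReal.ofReal (K * ∫ s in (t - T)..t, ‖f s‖) := ENNReal.ofReal_le_ofReal (hh t)
        _ = ENNReal.ofReal K * ENNReal.ofReal (∫ s in (t - T)..t, ‖f s‖) :=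
          ENNReal.ofReal_mul hK
        _ ≤ _ := by
          gcongr
          refine hint.trans (hcs.trans_eq ?_)
          rw [hvol]
          norm_num
    calc ‖h t‖ₑ ^ 2 ≤ (ENNReal.ofReal K * (eLpNorm f 2 (volume.restrict (Set.Ioc (t - T) t))
          * ENNReal.ofReal T ^ (1 / 2 : ℝ))) ^ 2 := by gcongr
      _ = _ := by
        rw [mul_pow, mul_pow, h2, ← ENNReal.rpow_natCast (_ ^ (1 / 2 : ℝ)), ← ENNReal.rpow_mul,
          ENNReal.ofReal_mul (by positivity), ENNReal.ofReal_pow hK]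
        norm_num
        ring
  -- A point `s` lies in the window `(t - T, t]` exactly when `t ∈ [s, s + T)`, a set of measure
  -- `T`.
  have hswap : ∫⁻ t, ∫⁻ s in Set.Ioc (t - T) t, ‖f s‖ₑ ^ 2
      = ENNReal.ofReal T * ∫⁻ s, ‖f s‖ₑ ^ 2 := by
    have hg : AEMeasurable (fun s => ‖f s‖ₑ ^ 2) volume := hf.1.enorm.pow_const 2
    have hmeas : MeasurableSet {p : ℝ × ℝ | p.1 - T < p.2 ∧ p.2 ≤ p.1} :=
      (measurableSet_lt (measurable_fst.sub_const T) measurable_snd).inter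
        (measurableSet_le measurable_snd measurable_fst)
    have e1 : ∀ t, ∫⁻ s in Set.Ioc (t - T) t, ‖f s‖ₑ ^ 2
        = ∫⁻ s, {p : ℝ × ℝ | p.1 - T < p.2 ∧ p.2 ≤ p.1}.indicator (fun p => ‖f p.2‖ₑ ^ 2) (t, s) :=
      fun t => by
        rw [← lintegral_indicator measurableSet_Ioc]
        rfl
    have e2 : ∀ s, ∫⁻ t, {p : ℝ × ℝ | p.1 - T < p.2 ∧ p.2 ≤ p.1}.indicator
        (fun p => ‖f p.2‖ₑ ^ 2) (t, s) = ENNReal.ofReal T * ‖f s‖ₑ ^ 2 := fun s => by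
      have : ∀ t, {p : ℝ × ℝ | p.1 - T < p.2 ∧ p.2 ≤ p.1}.indicator
          (fun p => ‖f p.2‖ₑ ^ 2) (t, s)
          = (Set.Ico s (s + T)).indicator (fun _ => ‖f s‖ₑ ^ 2) t := fun t => by
        simp only [Set.indicator_apply, Set.mem_ofPred_eq, Set.mem_Ico]
        congr 1
        rw [sub_lt_iff_lt_add, and_comm]
      simp_rw [this]
      rw [lintegral_indicator measurableSet_Ico, setLIntegral_const, Real.volume_Ico,
        add_sub_cancel_left, mul_comm]
    simp_rw [e1]
    rw [lintegral_lintegral_swap]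
    · simp_rw [e2]
      exact lintegral_const_mul'' _ hg
    · exact (hg.comp_snd).indicator hmeas
  have hfsq : (eLpNorm f 2) ^ 2 = ∫⁻ s, ‖f s‖ₑ ^ 2 := by
    simpa using eLpNorm_nnreal_pow_eq_lintegral (f := f) (μ := volume) (p := 2) two_ne_zero
  have hhsq : (eLpNorm h 2) ^ 2 = ∫⁻ s, ‖h s‖ₑ ^ 2 := by
    simpa using eLpNorm_nnreal_pow_eq_lintegral (f := h) (μ := volume) (p := 2) two_ne_zero
  rw [← ENNReal.pow_le_pow_left_iff two_ne_zero, mul_pow, hfsq, hhsq]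
  calc ∫⁻ t, ‖h t‖ₑ ^ 2 ≤ ∫⁻ t, ENNReal.ofReal (K ^ 2 * T)
        * ∫⁻ s in Set.Ioc (t - T) t, ‖f s‖ₑ ^ 2 := lintegral_mono hpt
    _ = _ := by
      rw [lintegral_const_mul' _ _ ENNReal.ofReal_ne_top, hswap, ← mul_assoc,
        ← ENNReal.ofReal_mul (by positivity), ← ENNReal.ofReal_pow (by positivity)]
      ring_nf

namespace PeriodicHamiltonian

variable {N : ℕ}

/-! ### The a priori estimate -/

lemma exists_norm_mulVec_le {Z : ℝ → Mat N} (hZ : Continuous Z) (a b : ℝ) :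
    ∃ K : ℝ, 0 ≤ K ∧ ∀ t ∈ Set.Icc a b, ∀ x : Fin (2 * N) → ℝ, ‖Z t *ᵥ x‖ ≤ K * ‖x‖ := by
  obtain ⟨K, hK⟩ := isCompact_Icc.exists_bound_of_continuousOn
    ((mulVecCLM N).continuous_of_finiteDimensional.comp hZ).continuousOn (s := Set.Icc a b)
  refine ⟨max K 0, le_max_right _ _, fun t ht x => ?_⟩
  rw [← mulVecCLM_apply]
  exact (mulVecCLM N (Z t)).le_of_opNorm_le ((hK t ht).trans (le_max_left _ _)) x

lemma norm_ofLp_le (x : E N) : ‖x.ofLp‖ ≤ ‖x‖ :=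
  (pi_norm_le_iff_of_nonneg (norm_nonneg x)).2 fun i => PiLp.norm_apply_le x i

lemma exists_norm_le_ofLp (N : ℕ) : ∃ c : ℝ, 0 ≤ c ∧ ∀ x : E N, ‖x‖ ≤ c * ‖x.ofLp‖ :=
  ⟨_, norm_nonneg ((EuclideanSpace.equiv (Fin (2 * N)) ℝ).symm :
    (Fin (2 * N) → ℝ) →L[ℝ] E N), fun x =>
    ((EuclideanSpace.equiv (Fin (2 * N)) ℝ).symm :
      (Fin (2 * N) → ℝ) →L[ℝ] E N).le_opNorm x.ofLp⟩

/-- Complexification of a real vector. -/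
def complexify (x : Fin (2 * N) → ℝ) : Fin (2 * N) → ℂ := fun i => (x i : ℂ)

lemma continuous_complexify : Continuous (complexify (N := N)) :=
  continuous_pi fun i => Complex.continuous_ofReal.comp (continuous_apply i)

lemma norm_complexify (x : Fin (2 * N) → ℝ) : ‖complexify x‖ = ‖x‖ := by
  simp [Pi.norm_def, complexify, nnnorm, Complex.norm_real]

lemma toLin'_complexify (B : Mat N) (x : Fin (2 * N) → ℝ) :
    Matrix.toLin' (B.map (algebraMap ℝ ℂ)) (complexify x) = complexify (B *ᵥ x) := by
  ext i
  exact (RingHom.map_mulVec (algebraMap ℝ ℂ) B x i).symm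

/-- The difference equation involves the transposed monodromy matrix, which has the same
characteristic polynomial as `X(T)`. -/
lemma exists_fundamentalMatrix_no_unit_eigenvalue {J : Mat N} (hJskew : Jᵀ = -J)
    (hJorth : Jᵀ * J = 1) {M : ℝ → Mat N} (hM : Continuous M) {T : ℝ} (hT : 0 < T)
    (hper : Function.Periodic M T)
    (hmult : ∀ ρ : ℂ, ‖ρ‖ = 1 → ¬ IsCharacteristicMultiplier J M T ρ) :
    ∃ X : ℝ → Mat N, X 0 = 1 ∧ IsMatrixSolution J M X ∧ ∀ ρ : ℂ, ‖ρ‖ = 1 →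
      ¬ Module.End.HasEigenvalue (Matrix.toLin' ((X T)ᵀ.map (algebraMap ℝ ℂ))) ρ := by
  obtain ⟨X, h0, hX⟩ := exists_isMatrixSolution J hM hT hper
  refine ⟨X, h0, hX, fun ρ hρ h => hmult ρ hρ
    ⟨X, hX.isFundamentalMatrix (mul_self_eq_neg_one hJskew hJorth) h0, ?_⟩⟩
  rw [Module.End.hasEigenvalue_iff_isRoot_charpoly, Matrix.charpoly_toLin'] at h ⊢
  rwa [Matrix.transpose_map, Matrix.charpoly_transpose] at h

/-- The position of `t` in its period. -/
noncomputable def phase (T t : ℝ) : ℝ := T * Int.fract (t / T)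

lemma measurable_phase (T : ℝ) : Measurable (phase T) :=
  (measurable_fract.comp (measurable_id.div_const T)).const_mul T

lemma phase_mem_Icc {T : ℝ} (hT : 0 < T) (t : ℝ) : phase T t ∈ Set.Icc 0 T :=
  ⟨mul_nonneg hT.le (Int.fract_nonneg _),
    mul_le_of_le_one_right hT.le (Int.fract_lt_one _).le⟩

lemma phase_sub_period {T : ℝ} (hT : T ≠ 0) (t : ℝ) : phase T (t - T) = phase T t := by
  rw [phase, phase, sub_div, div_self hT, Int.fract_sub_one]

lemma phase_eq {T : ℝ} (hT : T ≠ 0) (t : ℝ) : phase T t = t - ⌊t / T⌋ * T := by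
  rw [phase, Int.fract, mul_sub, mul_div_cancel₀ _ hT, mul_comm]

/-! ### The pairing restarted in every period, and the bound it yields. -/

section

variable {J : Mat N} {M X : ℝ → Mat N}

/-- The symplectic pairing of the solution `U` with the fundamental solutions, restarted in every
period. -/
noncomputable def floquetPairing (J : Mat N) (X : ℝ → Mat N) (T : ℝ) (U : ℝ → E N) (t : ℝ) :
    Fin (2 * N) → ℝ :=
  (X (phase T t))ᵀ *ᵥ (J *ᵥ (U t).ofLp)

lemma measurable_floquetPairing (hX : Continuous X) (T : ℝ) {U : ℝ → E N} (hU : Measurable U) :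
    Measurable (floquetPairing J X T U) := by
  have hcont : Continuous fun p : ℝ × E N => (X p.1)ᵀ *ᵥ (J *ᵥ p.2.ofLp) :=
    ((hX.comp continuous_fst).matrix_transpose).matrix_mulVec
      (continuous_const.matrix_mulVec ((PiLp.continuous_ofLp 2 _).comp continuous_snd))
  exact hcont.measurable.comp ((measurable_phase T).prodMk hU)

/-- Over one period the pairing evolves by the transposed monodromy matrix and a forcing term. -/
lemma norm_floquetPairing_sub_le (hJskew : Jᵀ = -J) (hJorth : Jᵀ * J = 1)
    (hMsymm : ∀ t, (M t).IsSymm) (hM : Continuous M) {T : ℝ} (hT : 0 < T)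
    (hper : Function.Periodic M T) (hX : IsMatrixSolution J M X) (h0 : X 0 = 1) {K : ℝ}
    (hK0 : 0 ≤ K)
    (hK : ∀ t ∈ Set.Icc 0 (2 * T), ∀ x : Fin (2 * N) → ℝ, ‖(X t)ᵀ *ᵥ x‖ ≤ K * ‖x‖)
    {U v : ℝ → E N} (hU : ∀ i, HasACDeriv (fun t => U t i) (fun t => v t i))
    (hf : LocallyIntegrable fun t => act J (v t) - act (M t) (U t)) (t : ℝ) :
    ‖floquetPairing J X T U (t - T) - (X T)ᵀ *ᵥ floquetPairing J X T U t‖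
      ≤ K * ∫ s in (t - T)..t, ‖act J (v s) - act (M s) (U s)‖ := by
  -- This whole number of periods moves the window `[t - T, t]` onto `[τ, τ + T]` with `τ = phase T
  -- t`, inside `[0, 2T]`, where `K` bounds `Xᵀ`.
  set c : ℝ := -((⌊t / T⌋ - 1 : ℤ) : ℝ) * T with hc
  have hcM : ∀ s, M (s + c) = M s := fun s => by
    have := hper.int_mul (-(⌊t / T⌋ - 1)) s
    rwa [Int.cast_neg] at this
  have hZ := hX.comp_add_const hcM
  have hb : t + c = phase T t + T := by
    rw [phase_eq hT.ne', hc]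
    push_cast
    ring
  have ha : t - T + c = phase T (t - T) := by
    rw [phase_sub_period hT.ne', sub_add_eq_add_sub, hb]
    ring
  have hint : ∀ k, floquetPairing J X T U (t - T) k - ((X T)ᵀ *ᵥ floquetPairing J X T U t) k
      = -∫ s in (t - T)..t, ((X (s + c))ᵀ *ᵥ (J *ᵥ (v s).ofLp - M s *ᵥ (U s).ofLp)) k := by
    intro k
    rw [(hZ.hasACDeriv_pairing hJorth hMsymm hM (U := fun s => (U s).ofLp)
      (v := fun s => (v s).ofLp) hU k).integral_eq_sub, ha, hb,
      hX.add_period hJskew hJorth hMsymm hM h0 hper, Matrix.transpose_mul,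
      ← Matrix.mulVec_mulVec, neg_sub]
    rfl
  have hle : t - T ≤ t := by linarith
  rw [← intervalIntegral.integral_const_mul]
  refine (pi_norm_le_iff_of_nonneg (intervalIntegral.integral_nonneg hle fun s _ => by
    positivity)).2 fun k => ?_
  rw [Pi.sub_apply, hint k, norm_neg]
  refine intervalIntegral.norm_integral_le_of_norm_le hle
    (Filter.Eventually.of_forall fun s hs => ?_) ?_
  · have hs' : s + c ∈ Set.Icc 0 (2 * T) := by
      have h1 := phase_mem_Icc hT t
      have h2 : t - T + c = phase T t := by rw [ha, phase_sub_period hT.ne']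
      constructor
      · linarith [h1.1, hs.1]
      · linarith [h1.2, hs.2]
    refine (norm_le_pi_norm _ k).trans ((hK _ hs' _).trans ?_)
    gcongr
    exact norm_ofLp_le (act J (v s) - act (M s) (U s))
  · exact (((hf.integrableOn_isCompact isCompact_uIcc).intervalIntegrable).norm).const_mul K

/-- The a priori estimate `‖U‖₂ ≤ C ‖J U' - M U‖₂`. -/
lemma exists_eLpNorm_le (hJskew : Jᵀ = -J) (hJorth : Jᵀ * J = 1)
    (hMsymm : ∀ t, (M t).IsSymm) (hM : Continuous M) {T : ℝ} (hT : 0 < T)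
    (hper : Function.Periodic M T)
    (hmult : ∀ ρ : ℂ, ‖ρ‖ = 1 → ¬ IsCharacteristicMultiplier J M T ρ) :
    ∃ C : ℝ, ∀ U v : ℝ → E N, (∀ i, HasACDeriv (fun t => U t i) (fun t => v t i)) →
      MemLp U 2 → MemLp (fun t => act J (v t) - act (M t) (U t)) 2 →
      eLpNorm U 2 ≤ ENNReal.ofReal C * eLpNorm (fun t => act J (v t) - act (M t) (U t)) 2 := by
  have hJ := mul_self_eq_neg_one hJskew hJorth
  obtain ⟨X, h0, hX, hX1⟩ := exists_fundamentalMatrix_no_unit_eigenvalue hJskew hJorth hM hT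
    hper hmult
  let P : (Fin (2 * N) → ℂ) →L[ℂ] (Fin (2 * N) → ℂ) :=
    LinearMap.toContinuousLinearMap (Matrix.toLin' ((X T)ᵀ.map (algebraMap ℝ ℂ)))
  obtain ⟨C₁, hC₁⟩ := exists_eLpNorm_le_of_no_unit_eigenvalue P T hX1
  obtain ⟨K, hK0, hK⟩ := exists_norm_mulVec_le hX.continuous.matrix_transpose 0 (2 * T)
  obtain ⟨K₁, hK₁0, hK₁⟩ := exists_norm_mulVec_le
    (hX.continuous.matrix_transpose.matrix_mul (continuous_const (y := J))) 0 T
  obtain ⟨K₂, hK₂0, hK₂⟩ := exists_norm_mulVec_le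
    (hX.continuous.matrix_mul (continuous_const (y := J))) 0 T
  obtain ⟨c, hc0, hc⟩ := exists_norm_le_ofLp N
  refine ⟨c * K₂ * (max C₁ 0 * (K * T)), fun U v hU hUL hfL => ?_⟩
  let w : ℝ → Fin (2 * N) → ℂ := fun t => complexify (floquetPairing J X T U t)
  have hUcont : Continuous U := (PiLp.continuous_toLp 2 _).comp
    (continuous_pi fun i => (hU i).continuous)
  -- Restarting keeps the argument of `X` in `[0, T]`, so `w` is dominated by `U`. Since `phase`
  -- jumps, `w` is treated as merely measurable.
  have hwL : MemLp w 2 := by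
    refine hUL.of_le_mul (c := K₁) (continuous_complexify.measurable.comp
      (measurable_floquetPairing hX.continuous T hUcont.measurable)).aestronglyMeasurable
      (Filter.Eventually.of_forall fun t => ?_)
    rw [norm_complexify, floquetPairing, Matrix.mulVec_mulVec]
    refine (hK₁ _ (phase_mem_Icc hT t) _).trans ?_
    gcongr
    exact norm_ofLp_le _
  have hUw : ∀ t, ‖U t‖ ≤ c * K₂ * ‖w t‖ := by
    intro t
    -- Symplecticity inverts the pairing: `X J Xᵀ J = J² = -1`.
    have h1 : (X (phase T t) * J) *ᵥ floquetPairing J X T U t = -(U t).ofLp := by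
      rw [floquetPairing, Matrix.mulVec_mulVec,
        hX.symplectic' hJskew hJorth hMsymm hM h0, Matrix.mulVec_mulVec, hJ, Matrix.neg_mulVec,
        Matrix.one_mulVec]
    have h2 := hK₂ _ (phase_mem_Icc hT t) (floquetPairing J X T U t)
    rw [h1, norm_neg] at h2
    rw [norm_complexify, mul_assoc]
    exact (hc _).trans (by gcongr)
  have hdiff : eLpNorm (fun t => w (t - T) - P (w t)) 2
      ≤ ENNReal.ofReal (K * T) * eLpNorm (fun t => act J (v t) - act (M t) (U t)) 2 := by
    refine eLpNorm_le_of_le_integral hfL hK0 hT.le fun t => ?_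
    have e : w (t - T) - P (w t)
        = complexify (floquetPairing J X T U (t - T) - (X T)ᵀ *ᵥ floquetPairing J X T U t) := by
      have : P (w t) = complexify ((X T)ᵀ *ᵥ floquetPairing J X T U t) := toLin'_complexify _ _
      rw [this]
      ext i
      simp [w, complexify]
    rw [e, norm_complexify]
    exact norm_floquetPairing_sub_le hJskew hJorth hMsymm hM hT hper hX h0 hK0 hK hU
      (hfL.locallyIntegrable (by norm_num)) t
  have h1 : eLpNorm U 2 ≤ ENNReal.ofReal (c * K₂) * eLpNorm w 2 :=
    eLpNorm_le_mul_eLpNorm_of_ae_le_mul (Filter.Eventually.of_forall hUw) 2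
  have h2 := hC₁ w hwL
  have h3 : ENNReal.ofReal C₁ ≤ ENNReal.ofReal (max C₁ 0) :=
    ENNReal.ofReal_le_ofReal (le_max_left _ _)
  rw [ENNReal.ofReal_mul (mul_nonneg hc0 hK₂0), ENNReal.ofReal_mul (le_max_right C₁ 0), mul_assoc,
    mul_assoc]
  exact h1.trans (mul_le_mul' le_rfl (h2.trans (mul_le_mul' h3 hdiff)))

end

end PeriodicHamiltonian

namespace PeriodicHamiltonian

variable {N : ℕ}

/-! ### The operator `L` -/

open scoped ENNReal InnerProductSpace

/-- The action of matrices on `ℝ^{2N}` as bounded operators. -/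
noncomputable def actL (N : ℕ) : Mat N →ₗ[ℝ] (E N →L[ℝ] E N) :=
  LinearMap.toContinuousLinearMap.toLinearMap ∘ₗ (Matrix.toEuclideanLin (𝕜 := ℝ)).toLinearMap

lemma actL_apply (A : Mat N) (x : E N) : actL N A x = act A x := rfl

lemma continuous_actL : Continuous (actL N) := (actL N).continuous_of_finiteDimensional

lemma act_act (A B : Mat N) (x : E N) : act A (act B x) = act (A * B) x := by
  simp [act, Matrix.mulVec_mulVec]

lemma act_neg_one (x : E N) : act (-1 : Mat N) x = -x := by
  ext i
  simp [act, Matrix.neg_mulVec]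

lemma inner_act_left (A : Mat N) (x y : E N) : ⟪act A x, y⟫_ℝ = ⟪x, act Aᵀ y⟫_ℝ := by
  simp only [act, EuclideanSpace.inner_eq_star_dotProduct, star_trivial]
  rw [Matrix.mulVec_transpose, dotProduct_comm, ← Matrix.dotProduct_mulVec, dotProduct_comm]

lemma memLp_top_actL {M : ℝ → Mat N} (hM : Continuous M) {T : ℝ} (hT : 0 < T)
    (hper : Function.Periodic M T) : MemLp (fun t => actL N (M t)) ∞ (volume : Measure ℝ) := by
  have hc : Continuous fun t => actL N (M t) := continuous_actL.comp hM
  have hp : Function.Periodic (fun t => actL N (M t)) T := fun t => by simp only [hper t]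
  obtain ⟨K, hK⟩ := (hp.isBounded_of_continuous hT.ne' hc).exists_norm_le
  exact memLp_top_of_bound hc.aestronglyMeasurable K
    (Filter.Eventually.of_forall fun t => hK _ ⟨t, rfl⟩)

/-- The pointwise application of a constant matrix on `L²`. -/
noncomputable def constMul (A : Mat N) : L2 N →L[ℝ] L2 N := (actL N A).compLpL 2 volume

lemma coeFn_constMul (A : Mat N) (u : L2 N) : ∀ᵐ t, constMul A u t = act A (u t) :=
  (actL N A).coeFn_compLpL u

/-- The pointwise application of a bounded matrix function on `L²`. -/
noncomputable def funMul {M : ℝ → Mat N}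
    (hM : MemLp (fun t => actL N (M t)) ∞ (volume : Measure ℝ)) : L2 N →L[ℝ] L2 N :=
  (ContinuousLinearMap.id ℝ (E N →L[ℝ] E N)).holderL volume ∞ 2 2 hM.toLp

lemma coeFn_funMul {M : ℝ → Mat N}
    (hM : MemLp (fun t => actL N (M t)) ∞ (volume : Measure ℝ)) (u : L2 N) :
    ∀ᵐ t, funMul hM u t = act (M t) (u t) := by
  filter_upwards [(ContinuousLinearMap.id ℝ (E N →L[ℝ] E N)).coeFn_holder (r := 2) hM.toLp u,
    hM.coeFn_toLp] with t h1 h2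
  refine h1.trans ?_
  rw [h2]
  rfl

/-- The operator `u ↦ J u' - M u` from `H¹` to `L²`. -/
noncomputable def hamiltonianOp (J : Mat N) {M : ℝ → Mat N}
    (hM : MemLp (fun t => actL N (M t)) ∞ (volume : Measure ℝ)) : H1 N →L[ℝ] L2 N :=
  (constMul J ∘L WithLp.sndL 2 ℝ (L2 N) (L2 N) - funMul hM ∘L WithLp.fstL 2 ℝ (L2 N) (L2 N))
    ∘L (H1 N).subtypeL

section

variable {J : Mat N} {M : ℝ → Mat N}

lemma hamiltonianOp_apply (hM : MemLp (fun t => actL N (M t)) ∞ (volume : Measure ℝ)) (u : H1 N) :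
    hamiltonianOp J hM u = constMul J (H1.weakDeriv u) - funMul hM (H1.val u) := rfl

lemma coeFn_hamiltonianOp (hM : MemLp (fun t => actL N (M t)) ∞ (volume : Measure ℝ))
    (u : H1 N) : ∀ᵐ t, hamiltonianOp J hM u t
      = act J (H1.weakDeriv u t) - act (M t) (H1.val u t) := by
  rw [hamiltonianOp_apply]
  filter_upwards [Lp.coeFn_sub (constMul J (H1.weakDeriv u)) (funMul hM (H1.val u)),
    coeFn_constMul J (H1.weakDeriv u), coeFn_funMul hM (H1.val u)] with t h1 h2 h3
  rw [h1, Pi.sub_apply, h2, h3]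

lemma constMul_constMul (hJ : J * J = -1) (u : L2 N) : constMul J (constMul J u) = -u := by
  refine Lp.ext ?_
  filter_upwards [coeFn_constMul J (constMul J u), coeFn_constMul J u, Lp.coeFn_neg u]
    with t h1 h2 h3
  rw [h1, h2, h3, act_act, hJ, act_neg_one, Pi.neg_apply]

/-! ### Completeness of `H¹` -/

/-- For a fixed test function, both sides of the weak derivative identity are continuous in the `L²`
pair. The resulting completeness of `H¹` is needed for the closed range and for the bounded inverse.
-/
lemma isClosed_H1 : IsClosed ((H1 N : Submodule ℝ (WithLp 2 (L2 N × L2 N))) :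
    Set (WithLp 2 (L2 N × L2 N))) := by
  let pair : Lp ℝ 2 (volume : Measure ℝ) →L[ℝ] L2 N →L[ℝ] E N :=
    (ContinuousLinearMap.lsmul ℝ ℝ).lpPairing volume 2 2
  have hpair : ∀ {ψ : ℝ → ℝ} (hψ : MemLp ψ 2) (u : L2 N), pair hψ.toLp u = ∫ t, ψ t • u t := by
    intro ψ hψ u
    refine ((ContinuousLinearMap.lsmul ℝ ℝ).lpPairing_eq_integral _ _).trans
      (integral_congr_ae ?_)
    filter_upwards [hψ.coeFn_toLp] with t ht
    rw [ht]
    rfl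
  have : ((H1 N : Submodule ℝ (WithLp 2 (L2 N × L2 N))) : Set (WithLp 2 (L2 N × L2 N)))
      = ⋂ (φ : ℝ → ℝ) (_ : ContDiff ℝ ∞ φ) (_ : HasCompactSupport φ),
        {p | ∫ t, deriv φ t • p.fst t = - ∫ t, φ t • p.snd t} := by
    ext p
    simp only [Set.mem_iInter]
    rfl
  rw [this]
  refine isClosed_iInter fun φ => isClosed_iInter fun hφ => isClosed_iInter fun hc => ?_
  have h1 : MemLp (deriv φ) 2 :=
    (hφ.continuous_deriv (by simp)).memLp_of_hasCompactSupport hc.deriv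
  have h2 : MemLp φ 2 := hφ.continuous.memLp_of_hasCompactSupport hc
  simp only [← hpair h1, ← hpair h2]
  exact isClosed_eq ((pair h1.toLp).continuous.comp (WithLp.fstL 2 ℝ (L2 N) (L2 N)).continuous)
    ((pair h2.toLp).continuous.comp (WithLp.sndL 2 ℝ (L2 N) (L2 N)).continuous).neg

instance : CompleteSpace (H1 N) := isClosed_H1.completeSpace_coe

/-! ### Bijectivity -/

/-- A vector-valued test function, as an element of `H¹`. -/
lemma exists_H1_testFunction {φ : ℝ → ℝ} (hφ : ContDiff ℝ ∞ φ) (hc : HasCompactSupport φ)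
    (e : E N) : ∃ p : H1 N, (∀ᵐ t, H1.val p t = φ t • e) ∧
      ∀ᵐ t, H1.weakDeriv p t = deriv φ t • e := by
  have hd : Continuous (deriv φ) := hφ.continuous_deriv (by simp)
  have h1 : MemLp (fun t => φ t • e) 2 :=
    (hφ.continuous.smul continuous_const).memLp_of_hasCompactSupport hc.smul_right
  have h2 : MemLp (fun t => deriv φ t • e) 2 :=
    (hd.smul continuous_const).memLp_of_hasCompactSupport hc.deriv.smul_right
  have hweak : IsWeakDeriv (h1.toLp : L2 N) h2.toLp := by
    intro ψ hψ hψc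
    have e1 : ∫ t, deriv ψ t • (h1.toLp : L2 N) t = ∫ t, (deriv ψ t * φ t) • e := by
      refine integral_congr_ae ?_
      filter_upwards [h1.coeFn_toLp] with t ht
      rw [ht, smul_smul]
    have e2 : ∫ t, ψ t • (h2.toLp : L2 N) t = ∫ t, (ψ t * deriv φ t) • e := by
      refine integral_congr_ae ?_
      filter_upwards [h2.coeFn_toLp] with t ht
      rw [ht, smul_smul]
    have hAC : HasACDeriv φ (deriv φ) := HasACDeriv.of_continuous_deriv hd
      fun t => (hφ.differentiable (by simp) t).hasDerivAt
    rw [e1, e2, integral_smul_const, integral_smul_const,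
      hAC.integral_deriv_mul_eq_neg (hψ.of_le (by simp)) hψc, neg_smul]
  exact ⟨⟨WithLp.toLp 2 (h1.toLp, h2.toLp), hweak⟩, h1.coeFn_toLp, h2.coeFn_toLp⟩

/-- Functions orthogonal to the range of `L` are weak solutions of `J v' = M v`. -/
lemma isWeakDeriv_of_mem_range_orthogonal (hJskew : Jᵀ = -J) (hJorth : Jᵀ * J = 1)
    (hMsymm : ∀ t, (M t).IsSymm)
    (hM : MemLp (fun t => actL N (M t)) ∞ (volume : Measure ℝ)) {v : L2 N}
    (hv : ∀ u : H1 N, ⟪hamiltonianOp J hM u, v⟫_ℝ = 0) :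
    IsWeakDeriv v (-(constMul J (funMul hM v))) := by
  have hJ := mul_self_eq_neg_one hJskew hJorth
  intro φ hφ hc
  have hd : Continuous (deriv φ) := hφ.continuous_deriv (by simp)
  set a := ∫ t, deriv φ t • v t
  set b := ∫ t, φ t • funMul hM v t with hb
  have ha_int : Integrable fun t => deriv φ t • v t := integrable_smul v hd hc.deriv
  have hb_int : Integrable fun t => φ t • funMul hM v t :=
    integrable_smul (funMul hM v) hφ.continuous hc
  -- Testing orthogonality with `u = φ e` gives `⟪J e, a⟫ = ⟪e, b⟫` for every `e`, that is, `Jᵀ a =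
  -- b`.
  have hab : -(act J a) = b := by
    refine ext_inner_left ℝ fun e => ?_
    obtain ⟨p, hp, hp'⟩ := exists_H1_testFunction hφ hc e
    have h0 := hv p
    rw [L2.inner_def] at h0
    have h1 : ∫ t, ⟪hamiltonianOp J hM p t, v t⟫_ℝ
        = ∫ t, (⟪act J e, deriv φ t • v t⟫_ℝ - ⟪e, φ t • funMul hM v t⟫_ℝ) := by
      refine integral_congr_ae ?_
      filter_upwards [coeFn_hamiltonianOp (J := J) hM p, hp, hp', coeFn_funMul hM v]
        with t h1 h2 h3 h4
      rw [h1, h2, h3, h4, ← actL_apply, ← actL_apply, map_smul, map_smul, inner_sub_left,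
        real_inner_smul_left, real_inner_smul_left, real_inner_smul_right, real_inner_smul_right,
        actL_apply, actL_apply, inner_act_left (M t), (hMsymm t).eq]
    rw [h1, integral_sub (ha_int.const_inner _) (hb_int.const_inner _), integral_inner ha_int,
      integral_inner hb_int, inner_act_left, hJskew, sub_eq_zero] at h0
    rw [← h0, ← actL_apply, ← actL_apply, map_neg, neg_apply]
  have hJb : act J b = a := by
    rw [← hab, ← actL_apply, map_neg, actL_apply, act_act, hJ, act_neg_one, neg_neg]
  rw [← hJb, hb, ← actL_apply, ← (actL N J).integral_comp_comm hb_int, ← integral_neg]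
  refine integral_congr_ae ?_
  filter_upwards [Lp.coeFn_neg (constMul J (funMul hM v)), coeFn_constMul J (funMul hM v)]
    with t h1 h2
  rw [h1, Pi.neg_apply, h2, map_smul, smul_neg, neg_neg, actL_apply]

/-- If `‖U‖₂ ≤ C ‖J U' - M U‖₂`, then `L` is bounded below on `H¹`. -/
lemma exists_norm_le_hamiltonianOp (hJskew : Jᵀ = -J) (hJorth : Jᵀ * J = 1)
    (hMsymm : ∀ t, (M t).IsSymm) (hMcont : Continuous M) {T : ℝ} (hT : 0 < T)
    (hper : Function.Periodic M T)
    (hmult : ∀ ρ : ℂ, ‖ρ‖ = 1 → ¬ IsCharacteristicMultiplier J M T ρ)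
    (hM : MemLp (fun t => actL N (M t)) ∞ (volume : Measure ℝ)) :
    ∃ C : NNReal, ∀ u : H1 N, ‖u‖ ≤ C * ‖hamiltonianOp J hM u‖ := by
  have hJ := mul_self_eq_neg_one hJskew hJorth
  obtain ⟨C, hC⟩ := exists_eLpNorm_le hJskew hJorth hMsymm hMcont hT hper hmult
  have hval : ∀ u : H1 N, ‖H1.val u‖ ≤ max C 0 * ‖hamiltonianOp J hM u‖ := by
    intro u
    obtain ⟨U, hU, hUe⟩ := IsWeakDeriv.exists_hasACDeriv (u := H1.val u) (v := H1.weakDeriv u) u.2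
    have hfe : (fun t => act J (H1.weakDeriv u t) - act (M t) (U t))
        =ᵐ[volume] hamiltonianOp J hM u := by
      filter_upwards [coeFn_hamiltonianOp (J := J) hM u, hUe] with t h1 h2
      rw [h1, h2]
    have h1 := hC U (H1.weakDeriv u) hU ((memLp_congr_ae hUe).1 (Lp.memLp _))
      ((memLp_congr_ae hfe).2 (Lp.memLp _))
    rw [← eLpNorm_congr_ae hUe, eLpNorm_congr_ae hfe] at h1
    rw [Lp.norm_def, Lp.norm_def]
    refine (ENNReal.toReal_mono (ENNReal.mul_ne_top ENNReal.ofReal_ne_top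
      (Lp.eLpNorm_ne_top _)) h1).trans_eq ?_
    rw [ENNReal.toReal_mul, ENNReal.toReal_ofReal']
  have hder : ∀ u : H1 N, ‖H1.weakDeriv u‖
      ≤ ‖constMul J‖ * (1 + ‖funMul hM‖ * max C 0) * ‖hamiltonianOp J hM u‖ := by
    intro u
    -- The equation, solved for the derivative using `J² = -1`, turns the bound on `u` into one on
    -- `u'`.
    have e : H1.weakDeriv u
        = -constMul J (hamiltonianOp J hM u + funMul hM (H1.val u)) := by
      rw [hamiltonianOp_apply, sub_add_cancel, constMul_constMul hJ, neg_neg]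
    have h1 := (funMul hM).le_opNorm_of_le (hval u)
    calc ‖H1.weakDeriv u‖ = ‖constMul J (hamiltonianOp J hM u + funMul hM (H1.val u))‖ := by
          rw [e, norm_neg]
      _ ≤ ‖constMul J‖ * (‖hamiltonianOp J hM u‖
            + ‖funMul hM‖ * (max C 0 * ‖hamiltonianOp J hM u‖)) :=
          (constMul J).le_opNorm_of_le ((norm_add_le _ _).trans (by gcongr))
      _ = _ := by ring
  have hC0 : 0 ≤ max C 0 + ‖constMul J‖ * (1 + ‖funMul hM‖ * max C 0) := by positivity
  refine ⟨NNReal.mk _ hC0, fun u => ?_⟩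
  rw [NNReal.coe_mk, add_mul]
  refine le_trans ?_ (add_le_add (hval u) (hder u))
  rw [H1.norm_eq]
  refine Real.sqrt_le_iff.2 ⟨by positivity, ?_⟩
  nlinarith [norm_nonneg (H1.val u), norm_nonneg (H1.weakDeriv u),
    mul_nonneg (norm_nonneg (H1.val u)) (norm_nonneg (H1.weakDeriv u))]

/-- If `L` is bounded below, it is onto: its range is closed, and orthogonal to the range there are
only solutions of `L v = 0`. -/
lemma range_hamiltonianOp_eq_top (hJskew : Jᵀ = -J) (hJorth : Jᵀ * J = 1)
    (hMsymm : ∀ t, (M t).IsSymm)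
    (hM : MemLp (fun t => actL N (M t)) ∞ (volume : Measure ℝ)) {C : NNReal}
    (hC : AntilipschitzWith C (hamiltonianOp J hM)) : (hamiltonianOp J hM).range = ⊤ := by
  have hclosed : IsClosed ((hamiltonianOp J hM).range : Set (L2 N)) :=
    hC.isClosed_range (hamiltonianOp J hM).uniformContinuous
  have : CompleteSpace (hamiltonianOp J hM).range := hclosed.completeSpace_coe
  rw [← Submodule.orthogonal_eq_bot_iff, Submodule.eq_bot_iff]
  intro v hv
  have hweak := isWeakDeriv_of_mem_range_orthogonal hJskew hJorth hMsymm hM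
    fun u => (Submodule.mem_orthogonal _ _).1 hv _ ⟨u, rfl⟩
  -- The weak equation gives `v` an `L²` derivative, so `v` belongs to the domain and injectivity of
  -- `L` applies to it.
  let p : H1 N := ⟨WithLp.toLp 2 (v, _), hweak⟩
  have hp : hamiltonianOp J hM p = 0 := by
    rw [hamiltonianOp_apply]
    change constMul J (-_) - funMul hM v = 0
    rw [map_neg, constMul_constMul (mul_self_eq_neg_one hJskew hJorth), neg_neg, sub_self]
  have hp0 : p = 0 := hC.injective (hp.trans (map_zero _).symm)
  exact congrArg H1.val hp0

end

end PeriodicHamiltonian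

theorem proposition5p2 (N : ℕ) (J : PeriodicHamiltonian.Mat N)
    (hJskew : Jᵀ = -J) (hJorth : Jᵀ * J = 1)
    (M : ℝ → PeriodicHamiltonian.Mat N) (hMsymm : ∀ t, (M t).IsSymm) (hMcont : Continuous M)
    (T : ℝ) (hT : 0 < T) (hMper : Function.Periodic M T)
    (hmult : ∀ ρ : ℂ, ‖ρ‖ = 1 → ¬ PeriodicHamiltonian.IsCharacteristicMultiplier J M T ρ) :
    ∃ L : PeriodicHamiltonian.H1 N ≃L[ℝ] PeriodicHamiltonian.L2 N,
      ∀ u : PeriodicHamiltonian.H1 N, ∀ᵐ t : ℝ,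
        L u t = PeriodicHamiltonian.act J (PeriodicHamiltonian.H1.weakDeriv u t)
          - PeriodicHamiltonian.act (M t) (PeriodicHamiltonian.H1.val u t) := by
  have hM := PeriodicHamiltonian.memLp_top_actL hMcont hT hMper
  obtain ⟨C, hC⟩ := PeriodicHamiltonian.exists_norm_le_hamiltonianOp hJskew hJorth hMsymm hMcont
    hT hMper hmult hM
  have hanti := (PeriodicHamiltonian.hamiltonianOp J hM).antilipschitz_of_bound hC
  -- Continuity of the inverse comes from the open mapping theorem, `H¹` and `L²` being complete.
  exact ⟨ContinuousLinearEquiv.ofBijective (PeriodicHamiltonian.hamiltonianOp J hM)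
    (LinearMap.ker_eq_bot.2 hanti.injective)
    (PeriodicHamiltonian.range_hamiltonianOp_eq_top hJskew hJorth hMsymm hM hanti),
    PeriodicHamiltonian.coeFn_hamiltonianOp hM⟩
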